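/- Terms are built over a finite signature of function symbols with fixed arities and a set $\mathcal V$ of variables. A \emph{rewrite preorder} is a preorder on terms closed under contexts and substitutions. An \emph{order pair} $({\geqslant},{>})$ consists of a preorder $\geqslant$ and a strict order $>$ with ${\geqslant}\cdot{>}\cdot{\geqslant}\subseteq{>}$; its lexicographic extension to lists is defined by: $(a_1,\dots,a_m)\geqslant^{\mathsf{lex}}(b_1,\dots,b_n)$ (respectively $>^{\mathsf{lex}}$) if either there is $k\leqslant\min(m,n)$ with $a_i\geqslant b_i$ for all $i<k$ and $a_k>b_k$, or $m\geqslant n$ (respectively $m>n$) and $a_i\geqslant b_i$ for all $i\leqslant n$ (the same definition is used for arbitrary pairs of relations). A relation $>$ is well-founded if there is no infinite sequence $a_0>a_1>a_2>\cdots$. A \emph{reduction triple} $({\geqslant},{\sqsupseteq},{\sqsupset})$ consists of a rewrite preorder $\geqslant$ on terms and an order pair $({\sqsupseteq},{\sqsupset})$ on terms such that $\sqsupseteq$ and $\sqsupset$ are closed under substitutions, $\sqsupset$ is well-founded, and $t_i\geqslant u$ implies $f(t_1,\dots,t_i,\dots,t_n)\sqsupseteq f(t_1,\dots,u,\dots,t_n)$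 for all $n$-ary function symbols $f$, terms $t_1,\dots,t_n,u$ and $1\leqslant i\leqslant n$. A \emph{reduction pair} $({\geqslant},{>})$ is an order pair on terms such that $\geqslant$ is a rewrite preorder and $>$ is well-founded and closed under substitutions. A \emph{partial status} $\pi$ maps each $n$-ary function symbol $f$ to a list $\pi(f)=[i_1,\dots,i_m]$ with $1\leqslant i_1<\dots<i_m\leqslant n$; write $\pi(f)(t_1,\dots,t_n)=[t_{i_1},\dots,t_{i_m}]$. A relation $\leadsto$ on terms is \emph{simple with respect to} $\pi$ if $f(t_1,\dots,t_n)\leadsto t_i$ for all $n$-ary $f$, terms $t_1,\dots,t_n$ and $i\in\pi(f)$. Given $\pi$ and triples $({\geqslant_A},{\sqsupseteq_A},{\sqsupset_A})$, $({\geqslant_B},{\sqsupseteq_B},{\sqsupset_B})$ of relations on terms, the pair $({\geqslant_{\mathsf G}},{>_{\mathsf G}})$ is defined simultaneously (by induction) as follows. $s\geqslant_{\mathsf G}t$ holds if (1) $s\sqsupset_A t$, or (2) $s\sqsupseteq_A t$ and one of the following holds: (a) $s=f(s_1,\dots,s_m)$ and $s_i\geqslant_{\mathsf G}t$ for some $i\in\pi(f)$;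 (b) $s=f(s_1,\dots,s_m)$, $t=g(t_1,\dots,t_n)$, $s>_{\mathsf G}t_j$ for all $j\in\pi(g)$, and either (i) $s\sqsupset_B t$, or (ii) $s\sqsupseteq_B t$ and $\pi(f)(s_1,\dots,s_m)\geqslant_{\mathsf G}^{\mathsf{lex}}\pi(g)(t_1,\dots,t_n)$; (c) $s\in\mathcal V$ and $s=t$. The relation $>_{\mathsf G}$ is defined by cases (1), (2a) and (2b), where in (2b) $\geqslant_{\mathsf G}^{\mathsf{lex}}$ is replaced by $>_{\mathsf G}^{\mathsf{lex}}$. Here $({\geqslant_{\mathsf G}^{\mathsf{lex}}},{>_{\mathsf G}^{\mathsf{lex}}})$ is the lexicographic extension of $({\geqslant_{\mathsf G}},{>_{\mathsf G}})$. Finally ${\geqslant_{\mathsf{MG}}}={\geqslant_A}\cap{\geqslant_B}\cap{\geqslant_{\mathsf G}}$. \textbf{Theorem.} Let $\pi$ be a partial status, and let $({\geqslant_A},{\sqsupseteq_A},{\sqsupset_A})$ and $({\geqslant_B},{\sqsupseteq_B},{\sqsupset_B})$ be reduction triples. If $\sqsupseteq_A$ is simple with respect to $\pi$, then $({\geqslant_{\mathsf{MG}}},{>_{\mathsf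 G}})$ is a reduction pair. -/

import Mathlib

universe u v w

namespace TermOrder


/-- Relations on the terms over the function symbols of `L` with variables in `V`.
(Relation symbols of `L` do not occur in terms and play no role.) -/
abbrev TermRel (L : FirstOrder.Language.{u, v}) (V : Type w) := L.Term V → L.Term V → Prop

/-- Contexts: terms with exactly one hole. In `node f ts i C` the `i`-th argument of `f` is the
context `C`, and the other arguments are given by `ts` (the entry `ts i` is ignored). -/
inductive Ctx (L : FirstOrder.Language.{u, v}) (V : Type w)
  | hole : Ctx L V
  | node {n : ℕ} (f : L.Functions n) (ts : Fin n → L.Term V) (i : Fin n) (C : Ctx L V) : Ctx L V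

/-- `C.fill t` replaces the hole of `C` by the term `t`. -/
def Ctx.fill {L : FirstOrder.Language.{u, v}} {V : Type w} : Ctx L V → L.Term V → L.Term V
  | .hole, t => t
  | .node f ts i C, t => .func f (Function.update ts i (C.fill t))

/-- Closure under substitutions (stability). -/
def ClosedUnderSubst {L : FirstOrder.Language.{u, v}} {V : Type w} (r : TermRel L V) : Prop :=
  ∀ (σ : V → L.Term V) (s t : L.Term V), r s t → r (s.subst σ) (t.subst σ)

/-- Closure under contexts. -/
def ClosedUnderCtx {L : FirstOrder.Language.{u, v}} {V : Type w} (r : TermRel L V) : Prop :=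
  ∀ (C : Ctx L V) (s t : L.Term V), r s t → r (C.fill s) (C.fill t)

/-- A rewrite preorder: a preorder on terms closed under substitutions and contexts. -/
structure IsRewritePreorder {L : FirstOrder.Language.{u, v}} {V : Type w} (ge : TermRel L V) : Prop where
  preorder : IsPreorder (L.Term V) ge
  subst : ClosedUnderSubst ge
  ctx : ClosedUnderCtx ge

/-- An order pair: a preorder `ge` and a strict order `gt` with `ge · gt · ge ⊆ gt`. -/
structure IsOrderPair {α : Type*} (ge gt : α → α → Prop) : Prop where
  preorder : IsPreorder α ge
  strictOrder : IsStrictOrder α gt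
  compat : ∀ a b c d : α, ge a b → gt b c → ge c d → gt a d

/-- There is no infinite descending sequence `a₀ > a₁ > a₂ > ⋯`. -/
def IsWellFoundedGT {α : Type*} (gt : α → α → Prop) : Prop :=
  WellFounded fun a b => gt b a

/-- `sge` is harmonious to `ge`: if `tᵢ ≥ u` then `f(t₁,…,tᵢ,…,tₙ) ⊒ f(t₁,…,u,…,tₙ)`. -/
def IsHarmonious {L : FirstOrder.Language.{u, v}} {V : Type w} (ge sge : TermRel L V) : Prop :=
  ∀ (n : ℕ) (f : L.Functions n) (ts : Fin n → L.Term V) (i : Fin n) (u : L.Term V),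
    ge (ts i) u → sge (.func f ts) (.func f (Function.update ts i u))

/-- Reduction triples `(≥, ⊒, ⊐)`. -/
structure IsReductionTriple {L : FirstOrder.Language.{u, v}} {V : Type w} (ge sge sgt : TermRel L V) : Prop where
  rewritePreorder : IsRewritePreorder ge
  orderPair : IsOrderPair sge sgt
  subst_sge : ClosedUnderSubst sge
  subst_sgt : ClosedUnderSubst sgt
  wellFounded : IsWellFoundedGT sgt
  harmonious : IsHarmonious ge sge

/-- Reduction pairs `(≥, >)`. -/
structure IsReductionPair {L : FirstOrder.Language.{u, v}} {V : Type w} (ge gt : TermRel L V) : Prop where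
  orderPair : IsOrderPair ge gt
  rewritePreorder : IsRewritePreorder ge
  wellFounded : IsWellFoundedGT gt
  subst_gt : ClosedUnderSubst gt

/-- A partial status assigns to every `n`-ary function symbol a strictly increasing list of
argument positions. -/
structure PartialStatus (L : FirstOrder.Language.{u, v}) where
  pos : ∀ {n : ℕ}, L.Functions n → List (Fin n)
  increasing : ∀ {n : ℕ} (f : L.Functions n), (pos f).Pairwise (· < ·)

/-- The list `π(f)(t₁,…,tₙ) = [t_{i₁},…,t_{iₘ}]` where `π(f) = [i₁,…,iₘ]`. -/
def PartialStatus.args {L : FirstOrder.Language.{u, v}} {V : Type w} (π : PartialStatus L) {n : ℕ}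
    (f : L.Functions n) (ts : Fin n → L.Term V) : List (L.Term V) :=
  (π.pos f).map ts

/-- `r` is simple with respect to `π`: `f(t₁,…,tₙ)` is related to `tᵢ` for all `i ∈ π(f)`. -/
def IsSimpleWrt {L : FirstOrder.Language.{u, v}} {V : Type w} (π : PartialStatus L) (r : TermRel L V) : Prop :=
  ∀ (n : ℕ) (f : L.Functions n) (ts : Fin n → L.Term V), ∀ i ∈ π.pos f, r (.func f ts) (ts i)

/-- The weak part of the lexicographic extension of `(ge, gt)` to lists. -/
inductive LexGE {α : Type*} (ge gt : α → α → Prop) : List α → List α → Prop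
  | nil (as : List α) : LexGE ge gt as []
  | strict {a b : α} (as bs : List α) : gt a b → LexGE ge gt (a :: as) (b :: bs)
  | weak {a b : α} {as bs : List α} :
      ge a b → LexGE ge gt as bs → LexGE ge gt (a :: as) (b :: bs)

/-- The strict part of the lexicographic extension of `(ge, gt)` to lists. -/
inductive LexGT {α : Type*} (ge gt : α → α → Prop) : List α → List α → Prop
  | nil (a : α) (as : List α) : LexGT ge gt (a :: as) []
  | strict {a b : α} (as bs : List α) : gt a b → LexGT ge gt (a :: as) (b :: bs)
  | weak {a b : α} {as bs : List α} :
      ge a b → LexGT ge gt as bs → LexGT ge gt (a :: as) (b :: bs)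

mutual

/-- The weak part `≥_G` of the generalized weighted path order with partial status `π` induced by
`(⊒_A, ⊐_A) = (sgeA, sgtA)` and `(⊒_B, ⊐_B) = (sgeB, sgtB)`. -/
inductive GwpoGE {L : FirstOrder.Language.{u, v}} {V : Type w} (π : PartialStatus L) (sgeA sgtA sgeB sgtB : TermRel L V) :
    L.Term V → L.Term V → Prop
  | case1 {s t : L.Term V} : sgtA s t → GwpoGE π sgeA sgtA sgeB sgtB s t
  | case2a {m : ℕ} {f : L.Functions m} {ss : Fin m → L.Term V} {t : L.Term V} (i : Fin m) :
      sgeA (.func f ss) t → i ∈ π.pos f → GwpoGE π sgeA sgtA sgeB sgtB (ss i) t →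
      GwpoGE π sgeA sgtA sgeB sgtB (.func f ss) t
  | case2b_i {m n : ℕ} {f : L.Functions m} {g : L.Functions n}
      {ss : Fin m → L.Term V} {ts : Fin n → L.Term V} :
      sgeA (.func f ss) (.func g ts) →
      (∀ j ∈ π.pos g, GwpoGT π sgeA sgtA sgeB sgtB (.func f ss) (ts j)) →
      sgtB (.func f ss) (.func g ts) →
      GwpoGE π sgeA sgtA sgeB sgtB (.func f ss) (.func g ts)
  | case2b_ii {m n : ℕ} {f : L.Functions m} {g : L.Functions n}
      {ss : Fin m → L.Term V} {ts : Fin n → L.Term V} :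
      sgeA (.func f ss) (.func g ts) →
      (∀ j ∈ π.pos g, GwpoGT π sgeA sgtA sgeB sgtB (.func f ss) (ts j)) →
      sgeB (.func f ss) (.func g ts) →
      LexGE (GwpoGE π sgeA sgtA sgeB sgtB) (GwpoGT π sgeA sgtA sgeB sgtB) (π.args f ss) (π.args g ts) →
      GwpoGE π sgeA sgtA sgeB sgtB (.func f ss) (.func g ts)
  | case2c (x : V) : sgeA (.var x) (.var x) → GwpoGE π sgeA sgtA sgeB sgtB (.var x) (.var x)

/-- The strict part `>_G` of the generalized weighted path order with partial status `π` induced by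
`(⊒_A, ⊐_A) = (sgeA, sgtA)` and `(⊒_B, ⊐_B) = (sgeB, sgtB)`. -/
inductive GwpoGT {L : FirstOrder.Language.{u, v}} {V : Type w} (π : PartialStatus L) (sgeA sgtA sgeB sgtB : TermRel L V) :
    L.Term V → L.Term V → Prop
  | case1 {s t : L.Term V} : sgtA s t → GwpoGT π sgeA sgtA sgeB sgtB s t
  | case2a {m : ℕ} {f : L.Functions m} {ss : Fin m → L.Term V} {t : L.Term V} (i : Fin m) :
      sgeA (.func f ss) t → i ∈ π.pos f → GwpoGE π sgeA sgtA sgeB sgtB (ss i) t →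
      GwpoGT π sgeA sgtA sgeB sgtB (.func f ss) t
  | case2b_i {m n : ℕ} {f : L.Functions m} {g : L.Functions n}
      {ss : Fin m → L.Term V} {ts : Fin n → L.Term V} :
      sgeA (.func f ss) (.func g ts) →
      (∀ j ∈ π.pos g, GwpoGT π sgeA sgtA sgeB sgtB (.func f ss) (ts j)) →
      sgtB (.func f ss) (.func g ts) →
      GwpoGT π sgeA sgtA sgeB sgtB (.func f ss) (.func g ts)
  | case2b_ii {m n : ℕ} {f : L.Functions m} {g : L.Functions n}
      {ss : Fin m → L.Term V} {ts : Fin n → L.Term V} :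
      sgeA (.func f ss) (.func g ts) →
      (∀ j ∈ π.pos g, GwpoGT π sgeA sgtA sgeB sgtB (.func f ss) (ts j)) →
      sgeB (.func f ss) (.func g ts) →
      LexGT (GwpoGE π sgeA sgtA sgeB sgtB) (GwpoGT π sgeA sgtA sgeB sgtB) (π.args f ss) (π.args g ts) →
      GwpoGT π sgeA sgtA sgeB sgtB (.func f ss) (.func g ts)

end

/-- The monotonic generalized weighted path order `≥_MG`, the intersection of `≥_A`, `≥_B`
and `≥_G`. -/
def MgwpoGE {L : FirstOrder.Language.{u, v}} {V : Type w} (π : PartialStatus L)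
    (geA sgeA sgtA geB sgeB sgtB : TermRel L V) : TermRel L V :=
  fun s t => geA s t ∧ geB s t ∧ GwpoGE π sgeA sgtA sgeB sgtB s t

end TermOrder

namespace TermOrder

-- Composition laws of order pairs

section OrderPair

variable {α : Type*} {ge gt : α → α → Prop}

-- Transitivity of `≥_G` and `>_G` is a joint structural induction on all three terms
-- (`gwpo_transFrom`), since clause (2b) mixes both relations. Simplicity of `⊒_A` makes a term
-- strictly larger than its `π`-arguments, which yields reflexivity and, through it, stability of
-- the variable clause.
--
-- Well-foundedness (`gwpoGT_wellFounded`) needs no Kruskal-type argument: accessibility is proved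
-- by nested inductions on `⊐_A`, term structure, `⊐_B`, the lexicographic order on accessible
-- argument lists (`acc_lexStep`) and the smaller term. A finite signature bounds arities; on lists
-- of unbounded length the lexicographic order can descend forever, as in [1], [0,1], [0,0,1], ….
--
-- A step `s ≥_G t` alone need not survive contexts, because `⊒_A` and `⊒_B` need not. Intersecting
-- with `≥_A` and `≥_B` repairs this: these pass through contexts, and harmony turns them into `⊒_A`
-- and `⊒_B` at every level.

theorem IsOrderPair.refl (h : IsOrderPair ge gt) (a : α) : ge a a :=
  h.preorder.toRefl.refl a

theorem IsOrderPair.trans (h : IsOrderPair ge gt) {a b c : α} (hab : ge a b) (hbc : ge b c) :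
    ge a c :=
  h.preorder.toIsTrans.trans a b c hab hbc

theorem IsOrderPair.gt_trans (h : IsOrderPair ge gt) {a b c : α} (hab : gt a b) (hbc : gt b c) :
    gt a c :=
  h.strictOrder.toIsTrans.trans a b c hab hbc

theorem IsOrderPair.ge_gt (h : IsOrderPair ge gt) {a b c : α} (hab : ge a b) (hbc : gt b c) :
    gt a c :=
  h.compat a b c c hab hbc (h.refl c)

theorem IsOrderPair.gt_ge (h : IsOrderPair ge gt) {a b c : α} (hab : gt a b) (hbc : ge b c) :
    gt a c :=
  h.compat a a b c (h.refl a) hab hbc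

end OrderPair

-- Lexicographic extension: transitivity and well-foundedness

section Lex

variable {α β ι : Type*} {ge gt : α → α → Prop}

theorem LexGT.lexGE {as bs : List α} (h : LexGT ge gt as bs) : LexGE ge gt as bs := by
  induction h with
  | nil a as => exact .nil _
  | strict as bs h => exact .strict _ _ h
  | weak h _ ih => exact .weak h ih

/-- Lists that are pointwise related by `ge` are related by the weak lexicographic extension. -/
theorem LexGE.map_of_forall {l : List ι} {f g : ι → α} (h : ∀ i ∈ l, ge (f i) (g i)) :
    LexGE ge gt (l.map f) (l.map g) := by
  induction l with
  | nil => exact .nil _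
  | cons i l ih =>
    exact .weak (h i (by simp)) (ih fun j hj => h j (by simp [hj]))

theorem LexGE.map {ge' gt' : β → β → Prop} (φ : α → β) {as bs : List α}
    (h : LexGE ge gt as bs)
    (hge : ∀ a ∈ as, ∀ b ∈ bs, ge a b → ge' (φ a) (φ b))
    (hgt : ∀ a ∈ as, ∀ b ∈ bs, gt a b → gt' (φ a) (φ b)) :
    LexGE ge' gt' (as.map φ) (bs.map φ) := by
  induction h with
  | nil as => exact .nil _
  | strict as bs h => exact .strict _ _ (hgt _ (by simp) _ (by simp) h)
  | weak h _ ih =>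
    exact .weak (hge _ (by simp) _ (by simp) h)
      (ih (fun a ha b hb => hge a (by simp [ha]) b (by simp [hb]))
        (fun a ha b hb => hgt a (by simp [ha]) b (by simp [hb])))

theorem LexGT.map {ge' gt' : β → β → Prop} (φ : α → β) {as bs : List α}
    (h : LexGT ge gt as bs)
    (hge : ∀ a ∈ as, ∀ b ∈ bs, ge a b → ge' (φ a) (φ b))
    (hgt : ∀ a ∈ as, ∀ b ∈ bs, gt a b → gt' (φ a) (φ b)) :
    LexGT ge' gt' (as.map φ) (bs.map φ) := by
  induction h with
  | nil a as => exact .nil _ _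
  | strict as bs h => exact .strict _ _ (hgt _ (by simp) _ (by simp) h)
  | weak h _ ih =>
    exact .weak (hge _ (by simp) _ (by simp) h)
      (ih (fun a ha b hb => hge a (by simp [ha]) b (by simp [hb]))
        (fun a ha b hb => hgt a (by simp [ha]) b (by simp [hb])))

/-- Transitivity of `(ge, gt)` from the element `a`, in all combinations with a weak step. -/
def TransFrom (ge gt : α → α → Prop) (a : α) : Prop :=
  ∀ b c, (ge a b → ge b c → ge a c) ∧ (gt a b → ge b c → gt a c) ∧ (ge a b → gt b c → gt a c)

/-- Transitivity is assumed only from entries of `as`: inside the induction of `gwpo_transFrom` it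
is known only for the arguments of the leftmost term. Two strict steps at one position compose after
`hle` weakens the second. -/
theorem LexGE.trans (hle : ∀ a b, gt a b → ge a b) {as bs cs : List α}
    (hT : ∀ a ∈ as, TransFrom ge gt a)
    (h₁ : LexGE ge gt as bs) (h₂ : LexGE ge gt bs cs) : LexGE ge gt as cs := by
  induction h₁ generalizing cs with
  | nil as => cases h₂; exact .nil _
  | strict as bs h =>
    cases h₂ with
    | nil => exact .nil _
    | strict _ _ h' => exact .strict _ _ ((hT _ (by simp) _ _).2.1 h (hle _ _ h'))
    | weak h' _ => exact .strict _ _ ((hT _ (by simp) _ _).2.1 h h')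
  | weak h _ ih =>
    cases h₂ with
    | nil => exact .nil _
    | strict _ _ h' => exact .strict _ _ ((hT _ (by simp) _ _).2.2 h h')
    | weak h' ht =>
      exact .weak ((hT _ (by simp) _ _).1 h h') (ih (fun a ha => hT a (by simp [ha])) ht)

theorem LexGT.trans_lexGE (hle : ∀ a b, gt a b → ge a b) {as bs cs : List α}
    (hT : ∀ a ∈ as, TransFrom ge gt a)
    (h₁ : LexGT ge gt as bs) (h₂ : LexGE ge gt bs cs) : LexGT ge gt as cs := by
  induction h₁ generalizing cs with
  | nil a as => cases h₂; exact .nil _ _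
  | strict as bs h =>
    cases h₂ with
    | nil => exact .nil _ _
    | strict _ _ h' => exact .strict _ _ ((hT _ (by simp) _ _).2.1 h (hle _ _ h'))
    | weak h' _ => exact .strict _ _ ((hT _ (by simp) _ _).2.1 h h')
  | weak h _ ih =>
    cases h₂ with
    | nil => exact .nil _ _
    | strict _ _ h' => exact .strict _ _ ((hT _ (by simp) _ _).2.2 h h')
    | weak h' ht =>
      exact .weak ((hT _ (by simp) _ _).1 h h') (ih (fun a ha => hT a (by simp [ha])) ht)

theorem LexGE.trans_lexGT (hle : ∀ a b, gt a b → ge a b) {as bs cs : List α}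
    (hT : ∀ a ∈ as, TransFrom ge gt a)
    (h₁ : LexGE ge gt as bs) (h₂ : LexGT ge gt bs cs) : LexGT ge gt as cs := by
  induction h₁ generalizing cs with
  | nil as => cases h₂
  | strict as bs h =>
    cases h₂ with
    | nil => exact .nil _ _
    | strict _ _ h' => exact .strict _ _ ((hT _ (by simp) _ _).2.1 h (hle _ _ h'))
    | weak h' _ => exact .strict _ _ ((hT _ (by simp) _ _).2.1 h h')
  | weak h _ ih =>
    cases h₂ with
    | nil => exact .nil _ _
    | strict _ _ h' => exact .strict _ _ ((hT _ (by simp) _ _).2.2 h h')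
    | weak h' ht =>
      exact .weak ((hT _ (by simp) _ _).1 h h') (ih (fun a ha => hT a (by simp [ha])) ht)

/-- The strict lexicographic extension, read from right to left and restricted on the smaller side
to lists of length at most `N` with entries that are accessible for `gt`. -/
def LexStep (ge gt : α → α → Prop) (N : ℕ) (bs as : List α) : Prop :=
  LexGT ge gt as bs ∧ bs.length ≤ N ∧ ∀ b ∈ bs, Acc (fun x y => gt y x) b

/-- Lists of bounded length with accessible entries are accessible for the strict lexicographic
extension. -/
theorem acc_lexStep (hrefl : ∀ a, ge a a) (hT : ∀ a, TransFrom ge gt a) (N : ℕ) {as : List α}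
    (hlen : as.length ≤ N) (has : ∀ a ∈ as, Acc (fun x y => gt y x) a) :
    Acc (LexStep ge gt N) as := by
  have hnil : ∀ N, Acc (LexStep ge gt N) [] := fun N => ⟨_, fun bs h => by cases h.1⟩
  induction N generalizing as with
  | zero =>
    obtain rfl : as = [] := List.length_eq_zero_iff.mp (Nat.le_zero.mp hlen)
    exact hnil 0
  | succ N ihN =>
    -- A weak step replaces the head by one that is only weakly smaller, hence no predecessor in the
    -- induction on `a`. The anchor `a` therefore stays fixed while the head `a'` ranges over
    -- everything weakly below it, and the tail decreases instead.
    have key : ∀ a, Acc (fun x y => gt y x) a → ∀ a', ge a a' → ∀ as : List α,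
        as.length ≤ N → (∀ x ∈ as, Acc (fun x y => gt y x) x) →
        Acc (LexStep ge gt (N + 1)) (a' :: as) := by
      intro a ha
      induction ha with
      | intro a _ iha =>
        intro a' haa' as hlen has
        have hacc := ihN hlen has
        clear hlen has
        induction hacc generalizing a' with
        | intro as _ ihas =>
          refine ⟨_, fun bs hbs => ?_⟩
          obtain ⟨hlex, hlen', hbs⟩ := hbs
          cases hlex with
          | nil => exact hnil _
          | strict _ bs h =>
            exact iha _ ((hT a _ _).2.2 haa' h) _ (hrefl _) bs (by simpa using hlen')
              fun x hx => hbs x (by simp [hx])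
          | weak h ht =>
            exact ihas _ ⟨ht, by simpa using hlen', fun x hx => hbs x (by simp [hx])⟩ _
              ((hT a _ _).1 haa' h)
    cases as with
    | nil => exact hnil _
    | cons a as =>
      exact key a (has a (by simp)) a (hrefl a) as (by simpa using hlen)
        fun x hx => has x (by simp [hx])

end Lex

-- The generalized weighted path order

section Gwpo

variable {L : FirstOrder.Language.{u, v}} {V : Type w} {π : PartialStatus L}
  {sgeA sgtA sgeB sgtB : TermRel L V}

theorem PartialStatus.mem_args {n : ℕ} {f : L.Functions n} {ts : Fin n → L.Term V}
    {t : L.Term V} : t ∈ π.args f ts ↔ ∃ i ∈ π.pos f, ts i = t := by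
  simp [PartialStatus.args]

theorem PartialStatus.length_args_le {n : ℕ} (f : L.Functions n) (ts : Fin n → L.Term V) :
    (π.args f ts).length ≤ n := by
  have hnodup : (π.pos f).Nodup := (π.increasing f).imp fun h => ne_of_lt h
  simpa [PartialStatus.args] using hnodup.length_le_card

theorem PartialStatus.args_subst {n : ℕ} (f : L.Functions n) (ts : Fin n → L.Term V)
    (σ : V → L.Term V) :
    π.args f (fun i => (ts i).subst σ) = (π.args f ts).map fun t => t.subst σ := by
  simp [PartialStatus.args, Function.comp_def]

theorem GwpoGT.gwpoGE {s t : L.Term V} (h : GwpoGT π sgeA sgtA sgeB sgtB s t) :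
    GwpoGE π sgeA sgtA sgeB sgtB s t := by
  cases h with
  | case1 h => exact .case1 h
  | case2a i h hi hs => exact .case2a i h hi hs
  | case2b_i h hj hB => exact .case2b_i h hj hB
  | case2b_ii h hj hB hlex => exact .case2b_ii h hj hB hlex.lexGE

/-- Clause (2b) applies: simplicity and reflexivity of the arguments give `s >_G s_j` by (2a). -/
theorem GwpoGE.refl (hA : IsOrderPair sgeA sgtA) (hB : IsOrderPair sgeB sgtB)
    (hsimple : IsSimpleWrt π sgeA) (s : L.Term V) : GwpoGE π sgeA sgtA sgeB sgtB s s := by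
  induction s with
  | var x => exact .case2c x (hA.refl _)
  | func f ss ih =>
    exact .case2b_ii (hA.refl _) (fun j hj => .case2a j (hsimple _ f ss j hj) hj (ih j))
      (hB.refl _) (LexGE.map_of_forall fun i _ => ih i)

/-- The clauses of the definitions of `≥_G` and `>_G` for two non-variable terms, with the
lexicographic comparison of the arguments replaced by `X`. -/
def GwpoCore (π : PartialStatus L) (sgeA sgtA sgeB sgtB : TermRel L V) (X : Prop)
    {m n : ℕ} (f : L.Functions m) (ss : Fin m → L.Term V) (g : L.Functions n)
    (ts : Fin n → L.Term V) : Prop :=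
  sgtA (.func f ss) (.func g ts) ∨
    (sgeA (.func f ss) (.func g ts) ∧
      ((∃ i ∈ π.pos f, GwpoGE π sgeA sgtA sgeB sgtB (ss i) (.func g ts)) ∨
        ((∀ j ∈ π.pos g, GwpoGT π sgeA sgtA sgeB sgtB (.func f ss) (ts j)) ∧
          (sgtB (.func f ss) (.func g ts) ∨ (sgeB (.func f ss) (.func g ts) ∧ X)))))

theorem GwpoCore.mono {X Y : Prop} {m n : ℕ} {f : L.Functions m} {ss : Fin m → L.Term V}
    {g : L.Functions n} {ts : Fin n → L.Term V}
    (h : GwpoCore π sgeA sgtA sgeB sgtB X f ss g ts) (hXY : X → Y) :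
    GwpoCore π sgeA sgtA sgeB sgtB Y f ss g ts :=
  h.imp_right (And.imp_right (Or.imp_right (And.imp_right (Or.imp_right (And.imp_right hXY)))))

theorem gwpoGE_func_func {m n : ℕ} {f : L.Functions m} {ss : Fin m → L.Term V}
    {g : L.Functions n} {ts : Fin n → L.Term V} :
    GwpoGE π sgeA sgtA sgeB sgtB (.func f ss) (.func g ts) ↔
      GwpoCore π sgeA sgtA sgeB sgtB
        (LexGE (GwpoGE π sgeA sgtA sgeB sgtB) (GwpoGT π sgeA sgtA sgeB sgtB)
          (π.args f ss) (π.args g ts)) f ss g ts := by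
  constructor
  · intro h
    cases h with
    | case1 h => exact .inl h
    | case2a i h hi hs => exact .inr ⟨h, .inl ⟨i, hi, hs⟩⟩
    | case2b_i h hj hb => exact .inr ⟨h, .inr ⟨hj, .inl hb⟩⟩
    | case2b_ii h hj hb hl => exact .inr ⟨h, .inr ⟨hj, .inr ⟨hb, hl⟩⟩⟩
  · rintro (h | ⟨h, ⟨i, hi, hs⟩ | ⟨hj, hb | ⟨hb, hl⟩⟩⟩)
    · exact .case1 h
    · exact .case2a i h hi hs
    · exact .case2b_i h hj hb
    · exact .case2b_ii h hj hb hl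

theorem gwpoGT_func_func {m n : ℕ} {f : L.Functions m} {ss : Fin m → L.Term V}
    {g : L.Functions n} {ts : Fin n → L.Term V} :
    GwpoGT π sgeA sgtA sgeB sgtB (.func f ss) (.func g ts) ↔
      GwpoCore π sgeA sgtA sgeB sgtB
        (LexGT (GwpoGE π sgeA sgtA sgeB sgtB) (GwpoGT π sgeA sgtA sgeB sgtB)
          (π.args f ss) (π.args g ts)) f ss g ts := by
  constructor
  · intro h
    cases h with
    | case1 h => exact .inl h
    | case2a i h hi hs => exact .inr ⟨h, .inl ⟨i, hi, hs⟩⟩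
    | case2b_i h hj hb => exact .inr ⟨h, .inr ⟨hj, .inl hb⟩⟩
    | case2b_ii h hj hb hl => exact .inr ⟨h, .inr ⟨hj, .inr ⟨hb, hl⟩⟩⟩
  · rintro (h | ⟨h, ⟨i, hi, hs⟩ | ⟨hj, hb | ⟨hb, hl⟩⟩⟩)
    · exact .case1 h
    · exact .case2a i h hi hs
    · exact .case2b_i h hj hb
    · exact .case2b_ii h hj hb hl

/-- Induction on the first term, then the second, then the third: each appeal to a hypothesis passes
to an argument of one term and keeps those before it. The three combinations need each other, so
they are proved together. -/
theorem gwpo_transFrom (hA : IsOrderPair sgeA sgtA) (hB : IsOrderPair sgeB sgtB)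
    (s : L.Term V) :
    TransFrom (GwpoGE π sgeA sgtA sgeB sgtB) (GwpoGT π sgeA sgtA sgeB sgtB) s := by
  have hle : ∀ a b, GwpoGT π sgeA sgtA sgeB sgtB a b → GwpoGE π sgeA sgtA sgeB sgtB a b :=
    fun _ _ h => h.gwpoGE
  induction s with
  | var x =>
    intro t u
    refine ⟨fun h₁ h₂ => ?_, fun h₁ h₂ => ?_, fun h₁ h₂ => ?_⟩
    · cases h₁ with
      | case1 h =>
        cases h₂ with
        | case1 h' => exact .case1 (hA.gt_trans h h')
        | case2a _ h' => exact .case1 (hA.gt_ge h h')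
        | case2b_i h' => exact .case1 (hA.gt_ge h h')
        | case2b_ii h' => exact .case1 (hA.gt_ge h h')
        | case2c _ h' => exact .case1 (hA.gt_ge h h')
      | case2c => exact h₂
    · cases h₁ with
      | case1 h =>
        cases h₂ with
        | case1 h' => exact .case1 (hA.gt_trans h h')
        | case2a _ h' => exact .case1 (hA.gt_ge h h')
        | case2b_i h' => exact .case1 (hA.gt_ge h h')
        | case2b_ii h' => exact .case1 (hA.gt_ge h h')
        | case2c _ h' => exact .case1 (hA.gt_ge h h')
    · cases h₁ with
      | case1 h =>
        cases h₂ with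
        | case1 h' => exact .case1 (hA.gt_trans h h')
        | case2a _ h' => exact .case1 (hA.gt_ge h h')
        | case2b_i h' => exact .case1 (hA.gt_ge h h')
        | case2b_ii h' => exact .case1 (hA.gt_ge h h')
      | case2c => exact h₂
  | func f ss ihs =>
    have ihargs : ∀ a ∈ π.args f ss,
        TransFrom (GwpoGE π sgeA sgtA sgeB sgtB) (GwpoGT π sgeA sgtA sgeB sgtB) a := by
      intro a ha
      obtain ⟨i, -, rfl⟩ := PartialStatus.mem_args.mp ha
      exact ihs i
    intro t
    induction t with
    | var x =>
      intro u
      -- With a variable in the middle, only (1) and (2a) can give the first step, and both are also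
      -- strict clauses; so even two weak steps compose strictly.
      have key : GwpoGE π sgeA sgtA sgeB sgtB (.func f ss) (.var x) →
          GwpoGE π sgeA sgtA sgeB sgtB (.var x) u →
          GwpoGT π sgeA sgtA sgeB sgtB (.func f ss) u := by
        intro h₁ h₂
        cases h₁ with
        | case1 h =>
          cases h₂ with
          | case1 h' => exact .case1 (hA.gt_trans h h')
          | case2c _ h' => exact .case1 (hA.gt_ge h h')
        | case2a i h hi hs =>
          have hsu := (ihs i _ _).1 hs h₂
          cases h₂ with
          | case1 h' => exact .case1 (hA.ge_gt h h')
          | case2c _ h' => exact .case2a i (hA.trans h h') hi hsu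
      exact ⟨fun h₁ h₂ => (key h₁ h₂).gwpoGE, fun h₁ h₂ => key h₁.gwpoGE h₂,
        fun h₁ h₂ => key h₁ h₂.gwpoGE⟩
    | func g ts iht =>
      intro u
      induction u with
      | var x =>
        have key : GwpoGE π sgeA sgtA sgeB sgtB (.func f ss) (.func g ts) →
            GwpoGE π sgeA sgtA sgeB sgtB (.func g ts) (.var x) →
            GwpoGT π sgeA sgtA sgeB sgtB (.func f ss) (.var x) := by
          intro h₁ h₂
          cases h₁ with
          | case1 h =>
            cases h₂ with
            | case1 h' => exact .case1 (hA.gt_trans h h')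
            | case2a _ h' => exact .case1 (hA.gt_ge h h')
          | case2a i h hi hs =>
            have hsu := (ihs i _ _).1 hs h₂
            cases h₂ with
            | case1 h' => exact .case1 (hA.ge_gt h h')
            | case2a _ h' => exact .case2a i (hA.trans h h') hi hsu
          | case2b_i h hj _ =>
            cases h₂ with
            | case1 h' => exact .case1 (hA.ge_gt h h')
            | case2a j h' hjm ht => exact (iht j _).2.1 (hj j hjm) ht
          | case2b_ii h hj _ _ =>
            cases h₂ with
            | case1 h' => exact .case1 (hA.ge_gt h h')
            | case2a j h' hjm ht => exact (iht j _).2.1 (hj j hjm) ht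
        exact ⟨fun h₁ h₂ => (key h₁ h₂).gwpoGE, fun h₁ h₂ => key h₁.gwpoGE h₂,
          fun h₁ h₂ => key h₁ h₂.gwpoGE⟩
      | func k us ihu =>
        -- `X`, `Y`, `Z` stand for the argument comparisons of the two steps and of their composite,
        -- so one case analysis serves all three combinations. If `s >_G t_j ≥_G u`, induction
        -- already gives a strict comparison, whose `LexGT` must be weakened to `Z`.
        have key : ∀ X Y Z : Prop, (X → Y → Z) →
            (LexGT (GwpoGE π sgeA sgtA sgeB sgtB) (GwpoGT π sgeA sgtA sgeB sgtB)
              (π.args f ss) (π.args k us) → Z) →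
            GwpoGE π sgeA sgtA sgeB sgtB (.func f ss) (.func g ts) →
            GwpoGE π sgeA sgtA sgeB sgtB (.func g ts) (.func k us) →
            GwpoCore π sgeA sgtA sgeB sgtB X f ss g ts →
            GwpoCore π sgeA sgtA sgeB sgtB Y g ts k us →
            GwpoCore π sgeA sgtA sgeB sgtB Z f ss k us := by
          intro X Y Z hXYZ hZ hst htu h₁ h₂
          rcases h₁ with h | ⟨h, h₁⟩
          · rcases h₂ with h' | ⟨h', -⟩
            · exact .inl (hA.gt_trans h h')
            · exact .inl (hA.gt_ge h h')
          rcases h₂ with h' | ⟨h', h₂⟩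
          · exact .inl (hA.ge_gt h h')
          rcases h₁ with ⟨i, hi, hs⟩ | ⟨hj, h₁⟩
          · exact .inr ⟨hA.trans h h', .inl ⟨i, hi, (ihs i _ _).1 hs htu⟩⟩
          rcases h₂ with ⟨j, hjm, ht⟩ | ⟨hj', h₂⟩
          · exact (gwpoGT_func_func.mp ((iht j _).2.1 (hj j hjm) ht)).mono hZ
          refine .inr ⟨hA.trans h h', .inr ⟨fun j hjm => (ihu j).2.2 hst (hj' j hjm), ?_⟩⟩
          rcases h₁ with hb | ⟨hb, hX⟩
          · rcases h₂ with hb' | ⟨hb', -⟩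
            · exact .inl (hB.gt_trans hb hb')
            · exact .inl (hB.gt_ge hb hb')
          · rcases h₂ with hb' | ⟨hb', hY⟩
            · exact .inl (hB.ge_gt hb hb')
            · exact .inr ⟨hB.trans hb hb', hXYZ hX hY⟩
        refine ⟨fun h₁ h₂ => gwpoGE_func_func.mpr (key _ _ _ (LexGE.trans hle ihargs) LexGT.lexGE
            h₁ h₂ (gwpoGE_func_func.mp h₁) (gwpoGE_func_func.mp h₂)),
          fun h₁ h₂ => gwpoGT_func_func.mpr (key _ _ _ (LexGT.trans_lexGE hle ihargs) id
            h₁.gwpoGE h₂ (gwpoGT_func_func.mp h₁) (gwpoGE_func_func.mp h₂)),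
          fun h₁ h₂ => gwpoGT_func_func.mpr (key _ _ _ (LexGE.trans_lexGT hle ihargs) id
            h₁ h₂.gwpoGE (gwpoGE_func_func.mp h₁) (gwpoGT_func_func.mp h₂))⟩

/-- Clause (2c) is the delicate one: the variable becomes an arbitrary term, so full reflexivity is
needed. -/
theorem gwpo_subst (hA : IsOrderPair sgeA sgtA) (hB : IsOrderPair sgeB sgtB)
    (hsimple : IsSimpleWrt π sgeA) (hAge : ClosedUnderSubst sgeA) (hAgt : ClosedUnderSubst sgtA)
    (hBge : ClosedUnderSubst sgeB) (hBgt : ClosedUnderSubst sgtB) (σ : V → L.Term V)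
    (s t : L.Term V) :
    (GwpoGE π sgeA sgtA sgeB sgtB s t →
      GwpoGE π sgeA sgtA sgeB sgtB (s.subst σ) (t.subst σ)) ∧
    (GwpoGT π sgeA sgtA sgeB sgtB s t →
      GwpoGT π sgeA sgtA sgeB sgtB (s.subst σ) (t.subst σ)) := by
  induction s generalizing t with
  | var x =>
    constructor <;> intro h
    · cases h with
      | case1 h => exact .case1 (hAgt σ _ _ h)
      | case2c => exact .refl hA hB hsimple _
    · cases h with
      | case1 h => exact .case1 (hAgt σ _ _ h)
  | func f ss ihs =>
    have harg : ∀ a ∈ π.args f ss, ∀ t,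
        (GwpoGE π sgeA sgtA sgeB sgtB a t →
          GwpoGE π sgeA sgtA sgeB sgtB (a.subst σ) (t.subst σ)) ∧
        (GwpoGT π sgeA sgtA sgeB sgtB a t →
          GwpoGT π sgeA sgtA sgeB sgtB (a.subst σ) (t.subst σ)) := by
      intro a ha
      obtain ⟨i, -, rfl⟩ := PartialStatus.mem_args.mp ha
      exact ihs i
    induction t with
    | var x =>
      constructor <;> intro h
      · cases h with
        | case1 h => exact .case1 (hAgt σ _ _ h)
        | case2a i h hi hs => exact .case2a i (hAge σ _ _ h) hi ((ihs i _).1 hs)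
      · cases h with
        | case1 h => exact .case1 (hAgt σ _ _ h)
        | case2a i h hi hs => exact .case2a i (hAge σ _ _ h) hi ((ihs i _).1 hs)
    | func g ts iht =>
      have key : ∀ X Y : Prop, (X → Y) → GwpoCore π sgeA sgtA sgeB sgtB X f ss g ts →
          GwpoCore π sgeA sgtA sgeB sgtB Y f (fun i => (ss i).subst σ)
            g (fun i => (ts i).subst σ) := by
        intro X Y hXY h
        rcases h with h | ⟨h, ⟨i, hi, hs⟩ | ⟨hj, h'⟩⟩
        · exact .inl (hAgt σ _ _ h)
        · exact .inr ⟨hAge σ _ _ h, .inl ⟨i, hi, (ihs i _).1 hs⟩⟩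
        · exact .inr ⟨hAge σ _ _ h, .inr ⟨fun j hjm => (iht j).2 (hj j hjm),
            h'.imp (hBgt σ _ _) (And.imp (hBge σ _ _) hXY)⟩⟩
      constructor <;> intro h
      · refine gwpoGE_func_func.mpr (key _ _ (fun hl => ?_) (gwpoGE_func_func.mp h))
        rw [PartialStatus.args_subst, PartialStatus.args_subst]
        exact hl.map _ (fun a ha b _ => (harg a ha b).1) fun a ha b _ => (harg a ha b).2
      · refine gwpoGT_func_func.mpr (key _ _ (fun hl => ?_) (gwpoGT_func_func.mp h))
        rw [PartialStatus.args_subst, PartialStatus.args_subst]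
        exact hl.map _ (fun a ha b _ => (harg a ha b).1) fun a ha b _ => (harg a ha b).2

/-- The strict part is well-founded: any term below `a` in the outer induction on `⊐_A` is
accessible, and the remaining terms are handled by induction on `⊐_B` and the lexicographic
extension. -/
theorem gwpoGT_wellFounded [Finite (Σ n, L.Functions n)]
    (hA : IsOrderPair sgeA sgtA) (hB : IsOrderPair sgeB sgtB)
    (hsimple : IsSimpleWrt π sgeA) (hwA : IsWellFoundedGT sgtA) (hwB : IsWellFoundedGT sgtB) :
    IsWellFoundedGT (GwpoGT π sgeA sgtA sgeB sgtB : TermRel L V) := by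
  obtain ⟨N, hN⟩ := (Set.finite_range fun f : Σ n, L.Functions n => f.1).bddAbove
  have harity : ∀ {n : ℕ}, L.Functions n → n ≤ N := fun {n} f => hN ⟨⟨n, f⟩, rfl⟩
  have hrefl := GwpoGE.refl (π := π) (V := V) hA hB hsimple
  have hT := gwpo_transFrom (π := π) (V := V) hA hB
  -- The anchor `a` bounds `s` through `⊒_A`, which persists along (2b) steps and down to
  -- `π`-arguments; any `⊐_A` step then falls under the induction hypothesis.
  have hmain : ∀ a s : L.Term V, sgeA a s →
      Acc (fun x y => GwpoGT π sgeA sgtA sgeB sgtB y x) s := by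
    intro a
    induction a using hwA.induction with
    | _ a ihA =>
    have hcase1 : ∀ s t, sgeA a s → sgtA s t →
        Acc (fun x y => GwpoGT π sgeA sgtA sgeB sgtB y x) t :=
      fun s t has hst => ihA t (hA.ge_gt has hst) t (hA.refl t)
    -- Likewise `b` is an anchor for `⊐_B`: a strict `⊐_B` step lowers it and restarts the argument
    -- list, a weak one keeps it and lowers the list.
    have hfunc : ∀ (b : L.Term V) (as : List (L.Term V)),
        Acc (LexStep (GwpoGE π sgeA sgtA sgeB sgtB) (GwpoGT π sgeA sgtA sgeB sgtB) N) as →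
        ∀ {m : ℕ} (f : L.Functions m) (ss : Fin m → L.Term V), sgeB b (.func f ss) →
        π.args f ss = as → sgeA a (.func f ss) →
        (∀ i ∈ π.pos f, Acc (fun x y => GwpoGT π sgeA sgtA sgeB sgtB y x) (ss i)) →
        Acc (fun x y => GwpoGT π sgeA sgtA sgeB sgtB y x) (.func f ss) := by
      intro b
      induction b using hwB.induction with
      | _ b ihB =>
      intro as has
      induction has with
      | intro as _ ihas =>
      intro m f ss hbf hargs haf hss
      refine ⟨_, fun t ht => ?_⟩
      have hsub : ∀ i ∈ π.pos f, ∀ t, GwpoGE π sgeA sgtA sgeB sgtB (ss i) t →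
          Acc (fun x y => GwpoGT π sgeA sgtA sgeB sgtB y x) t :=
        fun i hi t hst => ⟨_, fun u hu => (hss i hi).inv ((hT _ _ _).2.2 hst hu)⟩
      -- In clause (2b) each `π`-argument of `t` is itself strictly below `f(ss)`, so induction on
      -- `t` makes it accessible, as the list order requires.
      induction t with
      | var x =>
        cases ht with
        | case1 h => exact hcase1 _ _ haf h
        | case2a i h hi hs => exact hsub i hi _ hs
      | func g ts iht =>
        rcases gwpoGT_func_func.mp ht with h | ⟨h, ⟨i, hi, hs⟩ | ⟨hj, h'⟩⟩
        · exact hcase1 _ _ haf h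
        · exact hsub i hi _ hs
        · have hts : ∀ j ∈ π.pos g, Acc (fun x y => GwpoGT π sgeA sgtA sgeB sgtB y x) (ts j) :=
            fun j hjm => iht j (hj j hjm)
          have htargs : ∀ t ∈ π.args g ts,
              Acc (fun x y => GwpoGT π sgeA sgtA sgeB sgtB y x) t := by
            intro t ht
            obtain ⟨j, hjm, rfl⟩ := PartialStatus.mem_args.mp ht
            exact hts j hjm
          have hlen := (PartialStatus.length_args_le (π := π) g ts).trans (harity g)
          rcases h' with hb | ⟨hb, hl⟩
          · exact ihB _ (hB.ge_gt hbf hb) _ (acc_lexStep hrefl hT N hlen htargs) g ts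
              (hB.refl _) rfl (hA.trans haf h) hts
          · exact ihas _ ⟨hargs ▸ hl, hlen, htargs⟩ g ts (hB.trans hbf hb) rfl
              (hA.trans haf h) hts
    intro s
    induction s with
    | var x =>
      intro has
      refine ⟨_, fun t ht => ?_⟩
      cases ht with
      | case1 h => exact hcase1 _ _ has h
    | func f ss ihs =>
      intro has
      have hss : ∀ i ∈ π.pos f, Acc (fun x y => GwpoGT π sgeA sgtA sgeB sgtB y x) (ss i) :=
        fun i hi => ihs i (hA.trans has (hsimple _ f ss i hi))
      refine hfunc _ _ (acc_lexStep hrefl hT N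
        ((PartialStatus.length_args_le (π := π) f ss).trans (harity f)) fun t ht => ?_)
        f ss (hB.refl _) rfl has hss
      obtain ⟨i, hi, rfl⟩ := PartialStatus.mem_args.mp ht
      exact hss i hi
  exact ⟨fun s => hmain s s (hA.refl s)⟩

/-- The weak part is monotone along argumentwise steps that are weakly decreasing for `⊒_A` and `⊒_B`. -/
theorem GwpoGE.monotone (hA : IsOrderPair sgeA sgtA)
    (hsimple : IsSimpleWrt π sgeA) {n : ℕ} (f : L.Functions n) (ss ts : Fin n → L.Term V)
    (hsA : sgeA (.func f ss) (.func f ts)) (hsB : sgeB (.func f ss) (.func f ts))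
    (h : ∀ i, GwpoGE π sgeA sgtA sgeB sgtB (ss i) (ts i)) :
    GwpoGE π sgeA sgtA sgeB sgtB (.func f ss) (.func f ts) :=
  .case2b_ii hsA (fun j hj => .case2a j (hA.trans hsA (hsimple _ f ts j hj)) hj (h j)) hsB
    (LexGE.map_of_forall fun i _ => h i)

theorem IsHarmonious.update {ge sge : TermRel L V} (h : IsHarmonious ge sge) {n : ℕ}
    (f : L.Functions n) (ts : Fin n → L.Term V) (i : Fin n) {s t : L.Term V} (hst : ge s t) :
    sge (.func f (Function.update ts i s)) (.func f (Function.update ts i t)) := by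
  simpa using h n f (Function.update ts i s) i t (by simpa using hst)

/-- At each layer the `≥_A` and `≥_B` steps, already lifted through the inner context, supply the
root comparisons by harmony; only the `≥_G` component needs induction. -/
theorem mgwpoGE_closedUnderCtx {geA geB : TermRel L V} (hA : IsReductionTriple geA sgeA sgtA)
    (hB : IsReductionTriple geB sgeB sgtB) (hsimple : IsSimpleWrt π sgeA) :
    ClosedUnderCtx (MgwpoGE π geA sgeA sgtA geB sgeB sgtB) := by
  intro C s t hst
  refine ⟨hA.rewritePreorder.ctx C s t hst.1, hB.rewritePreorder.ctx C s t hst.2.1, ?_⟩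
  induction C with
  | hole => exact hst.2.2
  | node f ts i C ih =>
    refine GwpoGE.monotone hA.orderPair hsimple f _ _
      (hA.harmonious.update f ts i (hA.rewritePreorder.ctx C s t hst.1))
      (hB.harmonious.update f ts i (hB.rewritePreorder.ctx C s t hst.2.1)) fun j => ?_
    by_cases hj : j = i
    · subst hj
      simpa using ih
    · simpa [hj] using GwpoGE.refl hA.orderPair hB.orderPair hsimple (ts j)

end Gwpo

end TermOrder

theorem mainTheorem3 {L : FirstOrder.Language.{u, v}} [Finite (Σ n, L.Functions n)] {V : Type w}
    (π : TermOrder.PartialStatus L)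
    (geA sgeA sgtA geB sgeB sgtB : TermOrder.TermRel L V)
    (hA : TermOrder.IsReductionTriple geA sgeA sgtA)
    (hB : TermOrder.IsReductionTriple geB sgeB sgtB)
    (hsimple : TermOrder.IsSimpleWrt π sgeA) :
    TermOrder.IsReductionPair
      (TermOrder.MgwpoGE π geA sgeA sgtA geB sgeB sgtB)
      (TermOrder.GwpoGT π sgeA sgtA sgeB sgtB) := by
  have hT := TermOrder.gwpo_transFrom (π := π) hA.orderPair hB.orderPair
  have hpA := hA.rewritePreorder.preorder
  have hpB := hB.rewritePreorder.preorder
  have hwf := TermOrder.gwpoGT_wellFounded hA.orderPair hB.orderPair hsimple hA.wellFounded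
    hB.wellFounded
  have hsubst := TermOrder.gwpo_subst hA.orderPair hB.orderPair hsimple hA.subst_sge hA.subst_sgt
    hB.subst_sge hB.subst_sgt
  have hpre : IsPreorder (L.Term V) (TermOrder.MgwpoGE π geA sgeA sgtA geB sgeB sgtB) :=
    { refl := fun s => ⟨hpA.refl s, hpB.refl s,
        TermOrder.GwpoGE.refl hA.orderPair hB.orderPair hsimple s⟩
      trans := fun s t u h₁ h₂ => ⟨hpA.trans s t u h₁.1 h₂.1, hpB.trans s t u h₁.2.1 h₂.2.1,
        (hT s t u).1 h₁.2.2 h₂.2.2⟩ }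
  exact
    { orderPair :=
        { preorder := hpre
          strictOrder :=
            { irrefl := fun s hs => hwf.irrefl.irrefl s hs
              trans := fun s t u h₁ h₂ => (hT s t u).2.1 h₁ h₂.gwpoGE }
          compat := fun s t u r h₁ h₂ h₃ => (hT s u r).2.1 ((hT s t u).2.2 h₁.2.2 h₂) h₃.2.2 }
      rewritePreorder :=
        { preorder := hpre
          subst := fun σ s t h => ⟨hA.rewritePreorder.subst σ s t h.1,
            hB.rewritePreorder.subst σ s t h.2.1, (hsubst σ s t).1 h.2.2⟩
          ctx := TermOrder.mgwpoGE_closedUnderCtx hA hB hsimple }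
      wellFounded := hwf
      subst_gt := fun σ s t => (hsubst σ s t).2 }
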